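/- Let $H$ be a separable infinite-dimensional complex Hilbert space. For a positive compact operator $a$ on $H$ let $\lambda_1(a)\ge\lambda_2(a)\ge\cdots$ be its nonzero eigenvalues in decreasing order, repeated according to multiplicity, continued by zeros if $a$ has finite rank. Let $\alpha:\{0,1,2,\dots\}\to[0,\infty)$ be a monotone increasing function with $\alpha(0)=0$ and $\alpha(1)>0$. For a positive compact operator $a$ put $$\psi_\alpha(a)=\sup_{i\ge 1}\,\min\{\lambda_i(a),\alpha(i)\},$$ and for an arbitrary compact operator $a$ on $H$ put $\|a\|_\alpha=\psi_\alpha(|a|)$, where $|a|=(a^*a)^{1/2}$. Assume that $\alpha$ is concave in the sense that $$\frac{\alpha(i+1)+\alpha(i-1)}{2}\le\alpha(i)\qquad(i=1,2,3,\dots).$$ Then for all compact operators $b,c$ on $H$, $$\|b+c\|_\alpha\le\|b\|_\alpha+\|c\|_\alpha .$$ -/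

import Mathlib

noncomputable section

variable {H : Type*} [NormedAddCommGroup H] [InnerProductSpace ℂ H]

/-- The (algebraic) sum of the eigenspaces of `a` for the real eigenvalues `μ ≥ t`. As eigenspaces
for distinct eigenvalues are independent, its dimension is the number of eigenvalues `μ ≥ t`
of `a`, counted with multiplicity. -/
def eigenspacesGE (a : H →L[ℂ] H) (t : ℝ) : Submodule ℂ H :=
  ⨆ μ ∈ Set.Ici t, Module.End.eigenspace (a : H →ₗ[ℂ] H) (μ : ℂ)

/-- The eigenvalue sequence of a positive compact operator `a`: its nonzero eigenvalues in
decreasing order, counted with multiplicity, continued by zeros if there are only finitely many.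
Indices start at `0`, so `eigenvalueSeq a n` is `λ_{n+1}(a)`. It is the largest `t > 0` such that
at least `n + 1` eigenvalues of `a`, counted with multiplicity, are `≥ t`, and it is `0` if there
is no such `t` (in which case the supremum below is that of the empty set of reals). -/
def eigenvalueSeq (a : H →L[ℂ] H) (n : ℕ) : ℝ :=
  sSup {t : ℝ | 0 < t ∧ ((n + 1 : ℕ) : Cardinal) ≤ Module.rank ℂ (eigenspacesGE a t)}

/-- The non-linear trace of Sugeno type `ψ_α(a) = sup_{i ≥ 1} min (λ_i(a), α(i))` of a positive
compact operator `a`. The supremum is over `i = n + 1` with `n = 0, 1, 2, …`. -/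
def sugenoTrace (α : ℕ → ℝ) (a : H →L[ℂ] H) : ℝ :=
  ⨆ n : ℕ, min (eigenvalueSeq a n) (α (n + 1))

/-- `‖a‖_α = ψ_α(|a|)` for a compact operator `a`, where `|a| = (a* a)^{1/2}`. -/
def sugenoNorm [CompleteSpace H] (α : ℕ → ℝ) (a : H →L[ℂ] H) : ℝ :=
  sugenoTrace α (CFC.abs a)

/-- The sets whose suprema define the eigenvalue sequence are bounded. -/
theorem eigenvalueSeq_le_of_mem (a : H →L[ℂ] H) (n : ℕ) (t : ℝ)
    (ht : t ∈ {t : ℝ | 0 < t ∧ ((n + 1 : ℕ) : Cardinal) ≤ Module.rank ℂ (eigenspacesGE a t)}) :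
    t ≤ ‖a‖ := by
  by_contra! hlt
  have hbot : eigenspacesGE a t = ⊥ := by
    simp only [eigenspacesGE, iSup_eq_bot]
    intro μ hμ
    rw [Submodule.eq_bot_iff]
    intro x hx
    rw [Module.End.mem_eigenspace_iff] at hx
    have h1 : ‖a x‖ = |μ| * ‖x‖ := by
      have h0 : a x = (μ : ℂ) • x := hx
      rw [h0, norm_smul, Complex.norm_real, Real.norm_eq_abs]
    have h2 := a.le_opNorm x
    have h3 : t ≤ |μ| := le_trans hμ (le_abs_self μ)
    by_contra hne
    have h4 : 0 < ‖x‖ := norm_pos_iff.mpr hne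
    nlinarith
  have h := ht.2
  rw [hbot, rank_bot] at h
  norm_cast at h

theorem eigenvalueSeq_le (a : H →L[ℂ] H) (n : ℕ) : eigenvalueSeq a n ≤ ‖a‖ :=
  Real.sSup_le (eigenvalueSeq_le_of_mem a n) (norm_nonneg a)

/-- The supremum that defines `ψ_α(a)` is finite. -/
theorem bddAbove_sugenoTrace (α : ℕ → ℝ) (a : H →L[ℂ] H) :
    BddAbove (Set.range fun n : ℕ => min (eigenvalueSeq a n) (α (n + 1))) :=
  ⟨‖a‖, by rintro _ ⟨n, rfl⟩; exact (min_le_left _ _).trans (eigenvalueSeq_le a n)⟩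

end

/-! If the inequality fails, some `n` has both `λ_{n+1}(|b + c|)` and `α (n + 1)` above `‖b‖_α +
‖c‖_α`. Take `s > ‖b‖_α`, `t > ‖c‖_α` with `s + t < r`, where `|b + c|` has at least `n + 1`
eigenvalues `≥ r`. If `|b|` has `p` eigenvalues `≥ s` and `|c|` has `q` eigenvalues `≥ t`, then `α p
≤ ‖b‖_α` and `α q ≤ ‖c‖_α` (`le_sugenoTrace_of_le_rank`). Concavity makes `α` subadditive, so `α (p
+ q) < α (n + 1)` and `p + q ≤ n`. By dimension count, the spectral subspace of `|b + c|` contains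
some `x ≠ 0` orthogonal to the other two, and `r‖x‖ ≤ ‖(b + c) x‖ ≤ ‖b x‖ + ‖c x‖ ≤ (s + t)‖x‖`, a
contradiction. -/

open Module.End in
/-- Parseval for a vector in the algebraic sum of eigenspaces of a symmetric operator. -/
theorem LinearMap.IsSymmetric.exists_norm_sq_eq_of_mem_iSup_eigenspace {E ι : Type*}
    [NormedAddCommGroup E] [InnerProductSpace ℂ E] {T : E →ₗ[ℂ] E} (hT : T.IsSymmetric)
    {e : ι → ℂ} (he : Function.Injective e) {x : E} (hx : x ∈ ⨆ i, eigenspace T (e i)) :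
    ∃ (s : Finset ι) (v : ι → E), ‖x‖ ^ 2 = ∑ i ∈ s, ‖v i‖ ^ 2 ∧
      ‖T x‖ ^ 2 = ∑ i ∈ s, ‖e i‖ ^ 2 * ‖v i‖ ^ 2 := by
  obtain ⟨f, hf, rfl⟩ := (Submodule.mem_iSup_iff_exists_finsupp _ _).1 hx
  have hO := hT.orthogonalFamily_eigenspaces.comp he
  refine ⟨f.support, f, ?_, ?_⟩
  · simpa [Finsupp.sum] using hO.norm_sum (fun i => ⟨f i, hf i⟩) f.support
  · have h := hO.norm_sum (fun i => e i • ⟨f i, hf i⟩) f.support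
    have h1 : T (f.sum fun _ y => y) = ∑ i ∈ f.support, e i • f i := by
      rw [Finsupp.sum, map_sum]
      exact Finset.sum_congr rfl fun i _ => mem_eigenspace_iff.1 (hf i)
    rw [h1]
    simpa [norm_smul, mul_pow] using h

open Module.End in
theorem LinearMap.IsSymmetric.norm_apply_le_of_mem_iSup_eigenspace {E ι : Type*}
    [NormedAddCommGroup E] [InnerProductSpace ℂ E] {T : E →ₗ[ℂ] E} (hT : T.IsSymmetric)
    {e : ι → ℂ} (he : Function.Injective e) {t : ℝ} (ht : 0 ≤ t) (het : ∀ i, ‖e i‖ ≤ t)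
    {x : E} (hx : x ∈ ⨆ i, eigenspace T (e i)) : ‖T x‖ ≤ t * ‖x‖ := by
  obtain ⟨s, v, h1, h2⟩ := hT.exists_norm_sq_eq_of_mem_iSup_eigenspace he hx
  refine (sq_le_sq₀ (by positivity) (by positivity)).1 ?_
  rw [mul_pow, h1, h2, Finset.mul_sum]
  gcongr with i
  exact het i

open Module.End in
theorem LinearMap.IsSymmetric.le_norm_apply_of_mem_iSup_eigenspace {E ι : Type*}
    [NormedAddCommGroup E] [InnerProductSpace ℂ E] {T : E →ₗ[ℂ] E} (hT : T.IsSymmetric)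
    {e : ι → ℂ} (he : Function.Injective e) {t : ℝ} (ht : 0 ≤ t) (het : ∀ i, t ≤ ‖e i‖)
    {x : E} (hx : x ∈ ⨆ i, eigenspace T (e i)) : t * ‖x‖ ≤ ‖T x‖ := by
  obtain ⟨s, v, h1, h2⟩ := hT.exists_norm_sq_eq_of_mem_iSup_eigenspace he hx
  refine (sq_le_sq₀ (by positivity) (by positivity)).1 ?_
  rw [mul_pow, h1, h2, Finset.mul_sum]
  gcongr with i
  exact het i

/-- Project `x ∈ Vᗮ` onto the closure of `U`: the remainder is orthogonal to both `U` and `V`, hence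
zero. -/
theorem Submodule.orthogonal_le_topologicalClosure_of_isOrtho {E : Type*}
    [NormedAddCommGroup E] [InnerProductSpace ℂ E] [CompleteSpace E] {U V : Submodule ℂ E}
    (hUV : U ≤ Vᗮ) (h : (V ⊔ U)ᗮ = ⊥) : Vᗮ ≤ U.topologicalClosure := by
  intro x hx
  obtain ⟨y, hy, z, hz, rfl⟩ := U.topologicalClosure.exists_add_mem_mem_orthogonal x
  have hyV : y ∈ Vᗮ := U.topologicalClosure_minimal hUV V.isClosed_orthogonal hy
  have hzV : z ∈ Vᗮ := by simpa using sub_mem hx hyV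
  have hzU : z ∈ Uᗮ := Submodule.orthogonal_le U.le_topologicalClosure hz
  have hz0 : z ∈ (V ⊔ U)ᗮ := by
    rw [← Submodule.inf_orthogonal]; exact ⟨hzV, hzU⟩
  rw [h, Submodule.mem_bot] at hz0
  simpa [hz0] using hy

section

variable {H : Type*} [NormedAddCommGroup H] [InnerProductSpace ℂ H]

theorem eigenspacesGE_eq_iSup_subtype (a : H →L[ℂ] H) (t : ℝ) :
    eigenspacesGE a t =
      ⨆ μ : Set.Ici t, Module.End.eigenspace (a : H →ₗ[ℂ] H) ((μ : ℝ) : ℂ) :=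
  iSup_subtype'

theorem le_norm_apply_of_mem_eigenspacesGE {a : H →L[ℂ] H} (ha : a.IsPositive) {t : ℝ}
    (ht : 0 ≤ t) {x : H} (hx : x ∈ eigenspacesGE a t) : t * ‖x‖ ≤ ‖a x‖ := by
  rw [eigenspacesGE_eq_iSup_subtype] at hx
  refine ha.isSymmetric.le_norm_apply_of_mem_iSup_eigenspace
    (Complex.ofReal_injective.comp Subtype.val_injective) ht (fun μ => ?_) hx
  simpa using le_trans μ.2 (le_abs_self _)

/-- Eigenvalues are real and nonnegative, so every eigenspace lies in `eigenspacesGE a t` or in the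
span `U` of those with `‖μ‖ < t`. The bound holds on `U` and passes to its closure by continuity. -/
theorem norm_apply_le_of_mem_orthogonal_eigenspacesGE [CompleteSpace H] {a : H →L[ℂ] H}
    (ha : a.IsPositive)
    (htot : (⨆ μ : ℂ, Module.End.eigenspace (a : H →ₗ[ℂ] H) μ)ᗮ = ⊥) {t : ℝ} (ht : 0 ≤ t) {x : H}
    (hx : x ∈ (eigenspacesGE a t)ᗮ) : ‖a x‖ ≤ t * ‖x‖ := by
  set U : Submodule ℂ H :=
    ⨆ μ : {μ : ℂ // ‖μ‖ < t}, Module.End.eigenspace (a : H →ₗ[ℂ] H) (μ : ℂ) with hU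
  have hsymm : (a : H →ₗ[ℂ] H).IsSymmetric := ha.isSymmetric
  have hUV : U ≤ (eigenspacesGE a t)ᗮ := by
    refine Submodule.isOrtho_iff_le.1 ?_
    rw [hU, eigenspacesGE_eq_iSup_subtype, Submodule.isOrtho_iSup_left]
    refine fun μ => Submodule.isOrtho_iSup_right.2 fun ν => ?_
    refine hsymm.orthogonalFamily_eigenspaces.isOrtho fun h => ?_
    have h1 := μ.2
    rw [h, Complex.norm_real] at h1
    exact absurd (lt_of_le_of_lt (le_abs_self _) h1) (not_lt.2 ν.2)
  have hsup : (eigenspacesGE a t ⊔ U)ᗮ = ⊥ := by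
    refine eq_bot_iff.2 (le_trans (Submodule.orthogonal_le (iSup_le fun μ => ?_)) htot.le)
    by_cases hμ : Module.End.eigenspace (a : H →ₗ[ℂ] H) μ = ⊥
    · simp [hμ]
    have hev : Module.End.HasEigenvalue (a : H →ₗ[ℂ] H) μ := hμ
    have hre : ((μ.re : ℝ) : ℂ) = μ := Complex.conj_eq_iff_re.1 (hsymm.conj_eigenvalue_eq_self hev)
    rcases lt_or_ge ‖μ‖ t with h | h
    · exact le_trans (le_iSup (fun μ : {μ : ℂ // ‖μ‖ < t} =>
        Module.End.eigenspace (a : H →ₗ[ℂ] H) (μ : ℂ)) ⟨μ, h⟩) le_sup_right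
    · have hnn : 0 ≤ μ.re := by
        rw [← hre] at hev
        exact eigenvalue_nonneg_of_nonneg hev fun y => ha.re_inner_nonneg_right y
      have hle : t ≤ μ.re := by
        rwa [← hre, Complex.norm_real, Real.norm_of_nonneg hnn] at h
      refine le_trans ?_ le_sup_left
      rw [eigenspacesGE_eq_iSup_subtype]
      refine le_trans (le_of_eq ?_) (le_iSup (fun μ : Set.Ici t =>
        Module.End.eigenspace (a : H →ₗ[ℂ] H) ((μ : ℝ) : ℂ)) ⟨μ.re, hle⟩)
      rw [hre]
  have hcl := Submodule.orthogonal_le_topologicalClosure_of_isOrtho hUV hsup hx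
  refine closure_minimal (t := {y : H | ‖a y‖ ≤ t * ‖y‖}) (fun y hy => ?_)
    (isClosed_le (by fun_prop) (by fun_prop)) hcl
  exact hsymm.norm_apply_le_of_mem_iSup_eigenspace Subtype.val_injective ht (fun μ => μ.2.le) hy

theorem isPositive_abs [CompleteSpace H] (a : H →L[ℂ] H) : (CFC.abs a).IsPositive :=
  (ContinuousLinearMap.nonneg_iff_isPositive _).1 (CFC.abs_nonneg a)

theorem abs_apply_abs_apply [CompleteSpace H] (a : H →L[ℂ] H) (x : H) :
    CFC.abs a (CFC.abs a x) = ContinuousLinearMap.adjoint a (a x) :=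
  congrArg (fun T : H →L[ℂ] H => T x) (CFC.abs_mul_abs a)

theorem norm_abs_apply [CompleteSpace H] (a : H →L[ℂ] H) (x : H) : ‖CFC.abs a x‖ = ‖a x‖ := by
  have h : inner ℂ (CFC.abs a x) (CFC.abs a x) = inner ℂ (a x) (a x) := by
    rw [← (isPositive_abs a).inner_left_eq_inner_right, abs_apply_abs_apply,
      ContinuousLinearMap.adjoint_inner_left]
  rw [inner_self_eq_norm_sq_to_K, inner_self_eq_norm_sq_to_K] at h
  exact (sq_eq_sq₀ (norm_nonneg _) (norm_nonneg _)).1 (by exact_mod_cast h)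

/-- The eigenspaces of `|a|` span a dense subspace, since those of the compact operator `a* a` do. -/
theorem orthogonal_iSup_eigenspace_abs_eq_bot [CompleteSpace H] {a : H →L[ℂ] H}
    (ha : IsCompactOperator a) :
    (⨆ μ : ℂ, Module.End.eigenspace ((CFC.abs a : H →L[ℂ] H) : H →ₗ[ℂ] H) μ)ᗮ = ⊥ := by
  set q : H →L[ℂ] H := ContinuousLinearMap.adjoint a ∘L a with hq
  have hqpos : q.IsPositive := ContinuousLinearMap.isPositive_adjoint_comp_self a
  have hqc : IsCompactOperator q := ha.clm_comp (ContinuousLinearMap.adjoint a)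
  have hpos := isPositive_abs a
  have hqp : ∀ x, q x = CFC.abs a (CFC.abs a x) := fun x => (abs_apply_abs_apply a x).symm
  have htot := ContinuousLinearMap.orthogonalComplement_iSup_eigenspaces_eq_bot hqc
    hqpos.isSymmetric
  refine eq_bot_iff.2 (le_trans (Submodule.orthogonal_le (iSup_le fun μ => ?_)) htot.le)
  by_cases hμ : Module.End.eigenspace (q : H →ₗ[ℂ] H) μ = ⊥
  · exact hμ.le.trans bot_le
  have hev : Module.End.HasEigenvalue (q : H →ₗ[ℂ] H) μ := hμ
  have hre : ((μ.re : ℝ) : ℂ) = μ :=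
    Complex.conj_eq_iff_re.1 (LinearMap.IsSymmetric.conj_eigenvalue_eq_self hqpos.isSymmetric hev)
  have hnn : 0 ≤ μ.re := by
    rw [← hre] at hev
    exact eigenvalue_nonneg_of_nonneg hev fun y => hqpos.re_inner_nonneg_right y
  set r := √μ.re with hr
  have hr0 : 0 ≤ r := Real.sqrt_nonneg _
  have hrr : (r : ℂ) * r = μ := by
    rw [← Complex.ofReal_mul, Real.mul_self_sqrt hnn, hre]
  refine le_trans (fun x hx => ?_) (le_iSup _ (r : ℂ))
  have hx' : CFC.abs a (CFC.abs a x) = μ • x := by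
    rw [← hqp]; exact Module.End.mem_eigenspace_iff.1 hx
  refine Module.End.mem_eigenspace_iff.2 (show CFC.abs a x = (r : ℂ) • x from ?_)
  rcases hr0.eq_or_lt with h0 | hpos'
  · have hμ0 : μ = 0 := by rw [← hrr, ← h0]; simp
    have h1 : inner ℂ (CFC.abs a x) (CFC.abs a x) = (0 : ℂ) := by
      rw [← hpos.inner_left_eq_inner_right, hx', hμ0, zero_smul, inner_zero_left]
    rw [inner_self_eq_zero.1 h1, ← h0]; simp
  -- Since `(|a| + r)(|a| - r) = a* a - μ` kills `x`, `y` would be an eigenvector of `|a|` for `-r <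
  -- 0` unless it vanishes.
  · set y := CFC.abs a x - (r : ℂ) • x with hy
    have hay : CFC.abs a y = -((r : ℂ) • y) := by
      rw [hy, map_sub, map_smul, hx', ← hrr, smul_sub, mul_smul]; abel
    have h1 := hpos.re_inner_nonneg_left y
    rw [hay, inner_neg_left, inner_smul_left, inner_self_eq_norm_sq_to_K] at h1
    have h2 : 0 ≤ -(r * ‖y‖ ^ 2) := by
      have h3 : -((starRingEnd ℂ) (r : ℂ) * ((‖y‖ : ℝ) : ℂ) ^ 2) = ((-(r * ‖y‖ ^ 2) : ℝ) : ℂ) := by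
        rw [Complex.conj_ofReal]; push_cast; ring
      erw [h3] at h1
      exact h1
    have h4 : ‖y‖ = 0 := by
      by_contra hne
      have : 0 < ‖y‖ := lt_of_le_of_ne (norm_nonneg _) (Ne.symm hne)
      have : 0 < r * ‖y‖ ^ 2 := by positivity
      linarith
    exact sub_eq_zero.1 (norm_eq_zero.1 h4)

theorem eigenvalueSeq_nonneg (a : H →L[ℂ] H) (n : ℕ) : 0 ≤ eigenvalueSeq a n :=
  Real.sSup_nonneg fun _ ht => ht.1.le

theorem le_eigenvalueSeq {a : H →L[ℂ] H} {n : ℕ} {t : ℝ} (ht : 0 < t)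
    (hr : ((n + 1 : ℕ) : Cardinal) ≤ Module.rank ℂ (eigenspacesGE a t)) :
    t ≤ eigenvalueSeq a n :=
  le_csSup ⟨‖a‖, eigenvalueSeq_le_of_mem a n⟩ ⟨ht, hr⟩

theorem exists_lt_le_rank_of_lt_eigenvalueSeq {a : H →L[ℂ] H} {n : ℕ} {s : ℝ} (hs : 0 ≤ s)
    (h : s < eigenvalueSeq a n) :
    ∃ t, s < t ∧ ((n + 1 : ℕ) : Cardinal) ≤ Module.rank ℂ (eigenspacesGE a t) := by
  by_contra! hcon
  -- `0 ≤ s` covers the empty set, whose supremum is `0`.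
  refine h.not_ge (Real.sSup_le (fun t ht => ?_) hs)
  by_contra! hst
  exact (hcon t hst).not_ge ht.2

theorem sugenoTrace_nonneg {α : ℕ → ℝ} (hα : ∀ n, 0 ≤ α n) (a : H →L[ℂ] H) :
    0 ≤ sugenoTrace α a :=
  Real.iSup_nonneg fun n => le_min (eigenvalueSeq_nonneg a n) (hα _)

/-- Above the level `ψ_α(a)` there are at most `n` eigenvalues for some `n` with
`α(n) ≤ ψ_α(a)`. -/
theorem le_sugenoTrace_of_le_rank {α : ℕ → ℝ} (hα : ∀ n, 0 ≤ α n) (hα_zero : α 0 = 0)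
    {a : H →L[ℂ] H} {s : ℝ} (hs : sugenoTrace α a < s) {n : ℕ}
    (hn : (n : Cardinal) ≤ Module.rank ℂ (eigenspacesGE a s)) : α n ≤ sugenoTrace α a := by
  have h0 := sugenoTrace_nonneg hα a
  rcases n with _ | n
  · rwa [hα_zero]
  · have h1 := le_eigenvalueSeq (h0.trans_lt hs) hn
    have h2 : min (eigenvalueSeq a n) (α (n + 1)) ≤ sugenoTrace α a :=
      le_ciSup (bddAbove_sugenoTrace α a) n
    rcases min_le_iff.1 h2 with h | h
    · linarith
    · exact h

theorem Submodule.exists_ne_zero_mem_inf_orthogonal {V₁ V₂ W : Submodule ℂ H}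
    [FiniteDimensional ℂ V₁] [FiniteDimensional ℂ V₂] {n : ℕ}
    (hn : Module.finrank ℂ V₁ + Module.finrank ℂ V₂ < n) (hW : (n : Cardinal) ≤ Module.rank ℂ W) :
    ∃ x ∈ W, x ≠ 0 ∧ x ∈ V₁ᗮ ∧ x ∈ V₂ᗮ := by
  -- The joint kernel of the two projections on `W` is nonzero, the target being too small.
  set f : W →ₗ[ℂ] V₁ × V₂ :=
    (((V₁.orthogonalProjectionOnto : H →L[ℂ] V₁) : H →ₗ[ℂ] V₁).prod
      ((V₂.orthogonalProjectionOnto : H →L[ℂ] V₂) : H →ₗ[ℂ] V₂)).comp W.subtype with hf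
  have hninj : ¬ Function.Injective f := fun hinj => by
    have h := hW.trans (LinearMap.rank_le_of_injective f hinj)
    rw [← Module.finrank_eq_rank, Module.finrank_prod] at h
    exact hn.not_ge (by exact_mod_cast h)
  rw [← LinearMap.ker_eq_bot, Submodule.eq_bot_iff] at hninj
  push Not at hninj
  obtain ⟨x, hx, hx0⟩ := hninj
  have hx' : V₁.orthogonalProjectionOnto (x : H) = 0 ∧ V₂.orthogonalProjectionOnto (x : H) = 0 :=
    Prod.mk.inj (LinearMap.mem_ker.1 hx)
  refine ⟨x, x.2, by simpa using hx0, ?_, ?_⟩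
  · exact Submodule.orthogonalProjectionOnto_eq_zero_iff.1 hx'.1
  · exact Submodule.orthogonalProjectionOnto_eq_zero_iff.1 hx'.2

end

/-- Concavity makes the increments of `α` decrease, so a step from `m + n` gains at most the step
from `n`. -/
theorem add_le_of_concave_nat {α : ℕ → ℝ} (hα_zero : α 0 = 0)
    (hα_concave : ∀ i : ℕ, 1 ≤ i → (α (i + 1) + α (i - 1)) / 2 ≤ α i) (m n : ℕ) :
    α (m + n) ≤ α m + α n := by
  have hanti : Antitone fun k => α (k + 1) - α k := antitone_nat_of_succ_le fun k => by
    have := hα_concave (k + 1) (by omega)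
    simp only [Nat.add_sub_cancel] at this
    linarith
  induction n with
  | zero => simp [hα_zero]
  | succ n ih =>
    have := hanti (show n ≤ m + n by omega)
    simp only at this
    rw [← add_assoc]
    linarith

theorem mainTheorem8 {H : Type*} [NormedAddCommGroup H] [InnerProductSpace ℂ H] [CompleteSpace H]
    [TopologicalSpace.SeparableSpace H] (hH : ¬ FiniteDimensional ℂ H)
    (α : ℕ → ℝ) (hα_mono : Monotone α) (hα_zero : α 0 = 0) (hα_one : 0 < α 1)
    (hα_concave : ∀ i : ℕ, 1 ≤ i → (α (i + 1) + α (i - 1)) / 2 ≤ α i)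
    (b c : H →L[ℂ] H) (hb : IsCompactOperator b) (hc : IsCompactOperator c) :
    sugenoNorm α (b + c) ≤ sugenoNorm α b + sugenoNorm α c := by
  have hα : ∀ n, 0 ≤ α n := fun n => hα_zero ▸ hα_mono n.zero_le
  have hs0 : 0 ≤ sugenoNorm α b := sugenoTrace_nonneg hα _
  have ht0 : 0 ≤ sugenoNorm α c := sugenoTrace_nonneg hα _
  refine ciSup_le fun n => ?_
  by_contra! hlt
  obtain ⟨h1, h2⟩ := lt_min_iff.1 hlt
  obtain ⟨r, hr, hrank⟩ := exists_lt_le_rank_of_lt_eigenvalueSeq (add_nonneg hs0 ht0) h1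
  obtain ⟨s, hs, t, ht, hst⟩ : ∃ s, sugenoNorm α b < s ∧ ∃ t, sugenoNorm α c < t ∧ s + t < r :=
    ⟨sugenoNorm α b + (r - (sugenoNorm α b + sugenoNorm α c)) / 3, by linarith,
      sugenoNorm α c + (r - (sugenoNorm α b + sugenoNorm α c)) / 3, by linarith, by linarith⟩
  -- In infinite dimension the rank would exceed `n + 1`, forcing `α (n + 1) ≤ ‖a‖_α`.
  have hfin : ∀ {a : H →L[ℂ] H} {u : ℝ}, sugenoNorm α a < u → sugenoNorm α a < α (n + 1) →
      FiniteDimensional ℂ (eigenspacesGE (CFC.abs a) u) := fun {a u} hu hlt' => by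
    refine Module.rank_lt_aleph0_iff.1 (lt_of_not_ge fun hge => hlt'.not_ge ?_)
    exact le_sugenoTrace_of_le_rank hα hα_zero hu (Cardinal.natCast_lt_aleph0.le.trans hge)
  have := hfin hs (by linarith)
  have := hfin ht (by linarith)
  have hbn := le_sugenoTrace_of_le_rank hα hα_zero hs
    (Module.finrank_eq_rank ℂ (eigenspacesGE (CFC.abs b) s)).le
  have hcn := le_sugenoTrace_of_le_rank hα hα_zero ht
    (Module.finrank_eq_rank ℂ (eigenspacesGE (CFC.abs c) t)).le
  have hdim : Module.finrank ℂ (eigenspacesGE (CFC.abs b) s) +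
      Module.finrank ℂ (eigenspacesGE (CFC.abs c) t) < n + 1 := by
    by_contra! hge
    exact h2.not_ge ((hα_mono hge).trans ((add_le_of_concave_nat hα_zero hα_concave _ _).trans
      (add_le_add hbn hcn)))
  obtain ⟨x, hxW, hx0, hxb, hxc⟩ := Submodule.exists_ne_zero_mem_inf_orthogonal hdim hrank
  have hbx := norm_apply_le_of_mem_orthogonal_eigenspacesGE (isPositive_abs b)
    (orthogonal_iSup_eigenspace_abs_eq_bot hb) (hs0.trans hs.le) hxb
  have hcx := norm_apply_le_of_mem_orthogonal_eigenspacesGE (isPositive_abs c)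
    (orthogonal_iSup_eigenspace_abs_eq_bot hc) (ht0.trans ht.le) hxc
  have hx := le_norm_apply_of_mem_eigenspacesGE (isPositive_abs (b + c)) (by linarith) hxW
  rw [norm_abs_apply] at hbx hcx hx
  have hadd : ‖(b + c) x‖ ≤ ‖b x‖ + ‖c x‖ := norm_add_le _ _
  have hxpos : 0 < ‖x‖ := norm_pos_iff.2 hx0
  nlinarith
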